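/- Let $\Theta$ be a set of atomic propositions. Let $\mathcal L_C$ be the classical propositional language over $\Theta$ built from $\neg$ and $\to$, and let $\mathcal L\supseteq\mathcal L_C$ be the language over $\Theta$ built from $\neg$, $\to$, a modality $\Box$ and a binary conditional $(\psi|\phi)$. As usual, $\phi\vee\psi$ abbreviates $\neg\phi\to\psi$, $\phi\wedge\psi$ abbreviates $\neg(\neg\phi\vee\neg\psi)$, $\phi\leftrightarrow\psi$ abbreviates $(\phi\to\psi)\wedge(\psi\to\phi)$, and $\psi\times\phi$ (logical independence) abbreviates $\Box\bigl((\psi|\phi)\leftrightarrow\psi\bigr)$. Classical logic $C$ is the Hilbert system on $\mathcal L_C$ with modus ponens and the axiom schemes - c1: $\phi\to(\psi\to\phi)$, - c2: $(\eta\to(\phi\to\psi))\to((\eta\to\phi)\to(\eta\to\psi))$, - c3: $(\neg\phi\to\neg\psi)\to((\neg\phi\to\psi)\to\phi)$; write $\vdash_C\phi$ when $\phi$ is provable in it (equivalently, when $\phi$ is a classical tautology). The logic $\mathrm{DmBL}$ is the Hilbert system on $\mathcal L$ with modus ponens, the necessitation rule (from $\vdash\phi$ infer $\vdash\Box\phi$),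 and the axiom schemes c1–c3 (for all formulas of $\mathcal L$) together with - m2: $\Box(\phi\to\psi)\to(\Box\phi\to\Box\psi)$, - m3: $\Box\phi\to\phi$, - b1: $\Box(\phi\to\psi)\to\bigl(\Box\neg\phi\vee\Box(\psi|\phi)\bigr)$, - b2: $(\psi\to\eta\,|\,\phi)\to\bigl((\psi|\phi)\to(\eta|\phi)\bigr)$, - b3: $(\psi|\phi)\to(\phi\to\psi)$, - b4: $\neg(\neg\psi|\phi)\leftrightarrow(\psi|\phi)$, - b5: $(\psi\times\phi)\leftrightarrow(\phi\times\psi)$. The logic $\mathrm{DmBL}_\ast$ is obtained from $\mathrm{DmBL}$ by replacing b5 by the two schemes - b5.weak.A: $(\psi\times\neg\phi)\leftrightarrow(\psi\times\phi)$, - b5.weak.B: $\Box(\psi\leftrightarrow\eta)\to\Box\bigl((\phi|\psi)\leftrightarrow(\phi|\eta)\bigr)$. **Non-distortion.** Let $\phi\in\mathcal L_C$ be a classical proposition. 1. If $\Box\phi\vee\Box\neg\phi$ is provable in $\mathrm{DmBL}_\ast$, then $\vdash_C\phi$ or $\vdash_C\neg\phi$. 2. If $\Box\phi\vee\Box\neg\phi$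 is provable in $\mathrm{DmBL}$, then $\vdash_C\phi$ or $\vdash_C\neg\phi$. -/

import Mathlib

namespace BayesLogic

universe u

/-- The language of classical propositional logic over the atomic propositions `Θ`,
with primitive connectives negation and implication. -/
inductive ClassicalFormula (Θ : Type u) : Type u
  | atom : Θ → ClassicalFormula Θ
  | neg : ClassicalFormula Θ → ClassicalFormula Θ
  | imp : ClassicalFormula Θ → ClassicalFormula Θ → ClassicalFormula Θ

/-- The full conditional modal language over `Θ`: negation, implication, the modality `□`
and the conditional; `cond ψ φ` is the proposition `(ψ | φ)`, "`ψ` given `φ`". -/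
inductive Formula (Θ : Type u) : Type u
  | atom : Θ → Formula Θ
  | neg : Formula Θ → Formula Θ
  | box : Formula Θ → Formula Θ
  | imp : Formula Θ → Formula Θ → Formula Θ
  | cond : Formula Θ → Formula Θ → Formula Θ

/-- The inclusion of the classical language into the full language. -/
def ClassicalFormula.toFormula {Θ : Type u} : ClassicalFormula Θ → Formula Θ
  | .atom θ => .atom θ
  | .neg φ => .neg φ.toFormula
  | .imp φ ψ => .imp φ.toFormula ψ.toFormula

namespace Formula

variable {Θ : Type u}

/-- `φ ∨ ψ` abbreviates `¬φ → ψ`. -/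
def or (φ ψ : Formula Θ) : Formula Θ := imp (neg φ) ψ

/-- `φ ∧ ψ` abbreviates `¬(¬φ ∨ ¬ψ)`. -/
def and (φ ψ : Formula Θ) : Formula Θ := neg (or (neg φ) (neg ψ))

/-- `φ ↔ ψ` abbreviates `(φ → ψ) ∧ (ψ → φ)`. -/
def iff (φ ψ : Formula Θ) : Formula Θ := and (imp φ ψ) (imp ψ φ)

/-- Logical independence: `ψ × φ` abbreviates `□((ψ | φ) ↔ ψ)`. -/
def indep (ψ φ : Formula Θ) : Formula Θ := box (iff (cond ψ φ) ψ)

end Formula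

/-- Provability `⊢_C` in the classical logic `C`, all formulas being classical. -/
inductive ProvableC {Θ : Type u} : ClassicalFormula Θ → Prop
  | c1 (φ ψ : ClassicalFormula Θ) : ProvableC (.imp φ (.imp ψ φ))
  | c2 (η φ ψ : ClassicalFormula Θ) :
      ProvableC (.imp (.imp η (.imp φ ψ)) (.imp (.imp η φ) (.imp η ψ)))
  | c3 (φ ψ : ClassicalFormula Θ) :
      ProvableC (.imp (.imp (.neg φ) (.neg ψ)) (.imp (.imp (.neg φ) ψ) φ))
  | mp {φ ψ : ClassicalFormula Θ} : ProvableC φ → ProvableC (.imp φ ψ) → ProvableC ψ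

open Formula in
/-- The axioms common to DmBL and DmBL∗: classical (`c`), modal (`m`), Bayesian (`b`). -/
inductive CommonAxiom {Θ : Type u} : Formula Θ → Prop
  | c1 (φ ψ : Formula Θ) : CommonAxiom (imp φ (imp ψ φ))
  | c2 (η φ ψ : Formula Θ) :
      CommonAxiom (imp (imp η (imp φ ψ)) (imp (imp η φ) (imp η ψ)))
  | c3 (φ ψ : Formula Θ) :
      CommonAxiom (imp (imp (neg φ) (neg ψ)) (imp (imp (neg φ) ψ) φ))
  | m2 (φ ψ : Formula Θ) : CommonAxiom (imp (box (imp φ ψ)) (imp (box φ) (box ψ)))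
  | m3 (φ : Formula Θ) : CommonAxiom (imp (box φ) φ)
  | b1 (φ ψ : Formula Θ) :
      CommonAxiom (imp (box (imp φ ψ)) (or (box (neg φ)) (box (cond ψ φ))))
  | b2 (φ ψ η : Formula Θ) :
      CommonAxiom (imp (cond (imp ψ η) φ) (imp (cond ψ φ) (cond η φ)))
  | b3 (φ ψ : Formula Θ) : CommonAxiom (imp (cond ψ φ) (imp φ ψ))
  | b4 (φ ψ : Formula Θ) : CommonAxiom (iff (neg (cond (neg ψ) φ)) (cond ψ φ))

open Formula in
/-- The axioms of DmBL: the common ones and the symmetry `b5` of independence. -/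
inductive AxiomDmBL {Θ : Type u} : Formula Θ → Prop
  | common {φ : Formula Θ} : CommonAxiom φ → AxiomDmBL φ
  | b5 (φ ψ : Formula Θ) : AxiomDmBL (iff (indep ψ φ) (indep φ ψ))

open Formula in
/-- The axioms of DmBL∗: the common ones and the two weakenings of `b5`. -/
inductive AxiomDmBLStar {Θ : Type u} : Formula Θ → Prop
  | common {φ : Formula Θ} : CommonAxiom φ → AxiomDmBLStar φ
  | b5WeakA (φ ψ : Formula Θ) : AxiomDmBLStar (iff (indep ψ (neg φ)) (indep ψ φ))
  | b5WeakB (φ ψ η : Formula Θ) :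
      AxiomDmBLStar (imp (box (iff ψ η)) (box (iff (cond φ ψ) (cond φ η))))

/-- The theorems obtained from a set of axioms by modus ponens and necessitation (rule m1). -/
inductive Derivable {Θ : Type u} (Ax : Formula Θ → Prop) : Formula Θ → Prop
  | ax {φ : Formula Θ} : Ax φ → Derivable Ax φ
  | mp {φ ψ : Formula Θ} : Derivable Ax φ → Derivable Ax (.imp φ ψ) → Derivable Ax ψ
  | nec {φ : Formula Θ} : Derivable Ax φ → Derivable Ax (.box φ)

/-- Provability in DmBL. -/
def ProvableDmBL {Θ : Type u} (φ : Formula Θ) : Prop := Derivable AxiomDmBL φ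

/-- Provability in DmBL∗. -/
def ProvableDmBLStar {Θ : Type u} (φ : Formula Θ) : Prop := Derivable AxiomDmBLStar φ

end BayesLogic

/-! Suppose `C` proves neither `φ` nor `¬φ`. By completeness of `C`, some valuation falsifies `φ`
and another satisfies it. Taking these as two worlds, each accessible from both, makes `□φ` and
`□¬φ` false (`sat_toFormula`), whereas theorems of either logic are true at both worlds
(`sat_of_derivable`). The conditional picks one world at which to evaluate its consequent, hence
commutes with negation and implication. The default to the current world keeps b4 true for an
antecedent true nowhere. -/

namespace BayesLogic

universe v

variable {Θ : Type v}

/-! ### Completeness of classical logic -/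

namespace ClassicalFormula

/-- The truth of a classical formula under a valuation of the atoms. -/
def Holds (V : Θ → Prop) : ClassicalFormula Θ → Prop
  | atom θ => V θ
  | neg φ => ¬ φ.Holds V
  | imp φ ψ => φ.Holds V → ψ.Holds V

/-- Derivability in `C` from a set of hypotheses. -/
inductive Entails (Γ : Set (ClassicalFormula Θ)) : ClassicalFormula Θ → Prop
  | hyp {φ : ClassicalFormula Θ} : φ ∈ Γ → Entails Γ φ
  | thm {φ : ClassicalFormula Θ} : ProvableC φ → Entails Γ φ
  | mp {φ ψ : ClassicalFormula Θ} : Entails Γ φ → Entails Γ (imp φ ψ) → Entails Γ ψ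

namespace Entails

variable {Γ Δ : Set (ClassicalFormula Θ)} {φ ψ χ : ClassicalFormula Θ}

theorem provable (h : Entails ∅ φ) : ProvableC φ := by
  induction h with
  | hyp h => exact absurd h (Set.notMem_empty _)
  | thm h => exact h
  | mp _ _ ih₁ ih₂ => exact .mp ih₁ ih₂

theorem mono (hΓ : Γ ⊆ Δ) (h : Entails Γ φ) : Entails Δ φ := by
  induction h with
  | hyp h => exact .hyp (hΓ h)
  | thm h => exact .thm h
  | mp _ _ ih₁ ih₂ => exact .mp ih₁ ih₂

theorem weaken (h : Entails Γ φ) : Entails (insert ψ Γ) φ :=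
  h.mono (Set.subset_insert _ _)

theorem head : Entails (insert φ Γ) φ := .hyp (Set.mem_insert _ _)

theorem const (h : Entails Γ φ) : Entails Γ (imp ψ φ) := .mp h (.thm (.c1 _ _))

/-- The deduction theorem. -/
theorem deduction (h : Entails (insert ψ Γ) φ) : Entails Γ (imp ψ φ) := by
  induction h with
  | hyp h =>
    rcases h with h | h
    · rw [h]
      exact .thm (.mp (.c1 _ _) (.mp (.c1 _ (imp ψ ψ)) (.c2 _ _ _)))
    · exact (Entails.hyp h).const
  | thm h => exact (Entails.thm h).const
  | mp _ _ ih₁ ih₂ => exact .mp ih₁ (.mp ih₂ (.thm (.c2 _ _ _)))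

theorem by_contra (h : Entails (insert (neg φ) Γ) ψ)
    (hn : Entails (insert (neg φ) Γ) (neg ψ)) : Entails Γ φ :=
  .mp h.deduction (.mp hn.deduction (.thm (.c3 _ _)))

theorem absurd (h : Entails Γ φ) (hn : Entails Γ (neg φ)) : Entails Γ ψ :=
  by_contra h.weaken hn.weaken

theorem of_neg_neg (h : Entails Γ (neg (neg φ))) : Entails Γ φ :=
  by_contra head h.weaken

/-- c3 refutes only negated hypotheses, so double negation elimination is used to recover `φ` from
`¬¬φ`. -/
theorem neg_intro (h : Entails (insert φ Γ) ψ) (hn : Entails (insert φ Γ) (neg ψ)) :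
    Entails Γ (neg φ) :=
  by_contra (.mp (of_neg_neg head) h.deduction.weaken)
    (.mp (of_neg_neg head) hn.deduction.weaken)

theorem by_cases (h : Entails (insert ψ Γ) φ) (hn : Entails (insert (neg ψ) Γ) φ) :
    Entails Γ φ :=
  have key {χ : ClassicalFormula Θ} (h : Entails (insert χ Γ) φ) :
      Entails (insert (neg φ) Γ) (neg χ) :=
    neg_intro (.mp head h.deduction.weaken.weaken) head.weaken
  by_contra (key h) (key hn)

/-- A derivation uses finitely many hypotheses, so one member of the chain contains them all. -/
theorem exists_of_sUnion {c : Set (Set (ClassicalFormula Θ))} (hc : IsChain (· ⊆ ·) c)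
    (hne : c.Nonempty) (h : Entails (⋃₀ c) φ) : ∃ Γ ∈ c, Entails Γ φ := by
  induction h with
  | hyp h =>
    obtain ⟨Γ, hΓ, h⟩ := h
    exact ⟨Γ, hΓ, .hyp h⟩
  | thm h =>
    obtain ⟨Γ, hΓ⟩ := hne
    exact ⟨Γ, hΓ, .thm h⟩
  | mp _ _ ih₁ ih₂ =>
    obtain ⟨Γ₁, hΓ₁, h₁⟩ := ih₁
    obtain ⟨Γ₂, hΓ₂, h₂⟩ := ih₂
    rcases hc.total hΓ₁ hΓ₂ with h | h
    · exact ⟨Γ₂, hΓ₂, .mp (h₁.mono h) h₂⟩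
    · exact ⟨Γ₁, hΓ₁, .mp h₁ (h₂.mono h)⟩

end Entails

/-- Completeness of `C`: an unprovable formula fails under some valuation. -/
theorem exists_not_holds {φ : ClassicalFormula Θ} (hφ : ¬ ProvableC φ) :
    ∃ V : Θ → Prop, ¬ φ.Holds V := by
  -- Lindenbaum's construction: `M` is maximal among the sets that do not entail `φ`.
  obtain ⟨M, -, hM⟩ := zorn_subset_nonempty {Γ | ¬ Entails Γ φ}
    (fun c hc hchain hne => ⟨⋃₀ c, fun h => by
      obtain ⟨Γ, hΓ, h⟩ := h.exists_of_sUnion hchain hne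
      exact hc hΓ h, fun _ => Set.subset_sUnion_of_mem⟩) ∅ (fun h => hφ h.provable)
  have hMφ : ¬ Entails M φ := hM.prop
  have insert_of {ψ : ClassicalFormula Θ} (h : ψ ∉ M) : Entails (insert ψ M) φ := by
    by_contra hn
    exact h (hM.le_of_ge (y := insert ψ M) hn (Set.subset_insert _ _) (Set.mem_insert _ _))
  have closed {ψ : ClassicalFormula Θ} (h : Entails M ψ) : ψ ∈ M := by
    by_contra hn
    exact hMφ (.mp h (insert_of hn).deduction)
  have neg_iff (ψ : ClassicalFormula Θ) : neg ψ ∈ M ↔ ψ ∉ M :=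
    ⟨fun hn h => hMφ (.absurd (.hyp h) (.hyp hn)), fun h => by
      by_contra hn
      exact hMφ (.by_cases (insert_of h) (insert_of hn))⟩
  -- Truth lemma for the valuation that makes true exactly the atoms in `M`.
  have holds_iff (ψ : ClassicalFormula Θ) : ψ.Holds (fun θ => atom θ ∈ M) ↔ ψ ∈ M := by
    induction ψ with
    | atom θ => rfl
    | neg ψ ih => rw [Holds, ih, neg_iff]
    | imp ψ χ ih₁ ih₂ =>
      rw [Holds, ih₁, ih₂]
      refine ⟨fun h => closed ?_, fun h h' => closed (.mp (.hyp h') (.hyp h))⟩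
      by_cases hψ : ψ ∈ M
      · exact (Entails.hyp (h hψ)).const
      · exact (Entails.absurd .head
          (Entails.hyp ((neg_iff ψ).2 hψ)).weaken).deduction
  exact ⟨_, fun h => hMφ (.hyp ((holds_iff φ).1 h))⟩

end ClassicalFormula

/-! ### Two-world semantics and soundness -/

namespace Formula

/-- Truth in the model with the two worlds `true` and `false`. Necessity is truth at both worlds,
and `(ψ | φ)` is the truth of `ψ` at the nearest world satisfying `φ`, or at the current world
if there is none. -/
def Sat (V : Bool → Θ → Prop) : Formula Θ → Bool → Prop
  | atom θ, w => V w θ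
  | neg φ, w => ¬ φ.Sat V w
  | box φ, w => φ.Sat V w ∧ φ.Sat V (!w)
  | imp φ ψ, w => φ.Sat V w → ψ.Sat V w
  | cond ψ φ, w =>
      ((φ.Sat V w ∨ ¬ φ.Sat V (!w)) ∧ ψ.Sat V w) ∨
        (¬ φ.Sat V w ∧ φ.Sat V (!w) ∧ ψ.Sat V (!w))

variable {V : Bool → Θ → Prop} {φ : Formula Θ}

theorem sat_of_commonAxiom (h : CommonAxiom φ) (w : Bool) : φ.Sat V w := by
  cases h <;> simp only [Sat, Formula.or, Formula.and, Formula.iff, Bool.not_not] <;> tauto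

/-- If `φ` has the same truth value at both worlds, `(ψ | φ)` agrees with `ψ`; otherwise it is
constant, with the value of `ψ` at the only `φ`-world. So independence means that `φ` or `ψ` is
constant, a symmetric condition. -/
theorem sat_indep_comm (φ ψ : Formula Θ) (w : Bool) :
    (indep ψ φ).Sat V w ↔ (indep φ ψ).Sat V w := by
  simp only [Sat, indep, Formula.or, Formula.and, Formula.iff, Bool.not_not]
  by_cases h₁ : φ.Sat V w <;> by_cases h₂ : φ.Sat V (!w) <;>
    by_cases h₃ : ψ.Sat V w <;> by_cases h₄ : ψ.Sat V (!w) <;> simp [h₁, h₂, h₃, h₄]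

/-- Negation preserves constancy across the two worlds. -/
theorem sat_indep_neg (φ ψ : Formula Θ) (w : Bool) :
    (indep ψ (neg φ)).Sat V w ↔ (indep ψ φ).Sat V w := by
  simp only [Sat, indep, Formula.or, Formula.and, Formula.iff, Bool.not_not]
  by_cases h₁ : φ.Sat V w <;> by_cases h₂ : φ.Sat V (!w) <;>
    by_cases h₃ : ψ.Sat V w <;> by_cases h₄ : ψ.Sat V (!w) <;> simp [h₁, h₂, h₃, h₄]

theorem sat_iff {ψ : Formula Θ} {w : Bool} :
    (Formula.iff φ ψ).Sat V w ↔ (φ.Sat V w ↔ ψ.Sat V w) := by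
  simp only [Sat, Formula.or, Formula.and, Formula.iff]
  tauto

theorem sat_of_axiomDmBL (h : AxiomDmBL φ) (w : Bool) : φ.Sat V w := by
  cases h with
  | common h => exact sat_of_commonAxiom h w
  | b5 φ ψ => exact sat_iff.2 (sat_indep_comm φ ψ w)

theorem sat_of_axiomDmBLStar (h : AxiomDmBLStar φ) (w : Bool) : φ.Sat V w := by
  cases h with
  | common h => exact sat_of_commonAxiom h w
  | b5WeakA φ ψ => exact sat_iff.2 (sat_indep_neg φ ψ w)
  | b5WeakB φ ψ η =>
    -- Antecedents that agree at both worlds select the same world.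
    simp only [Sat, sat_iff, Bool.not_not]
    rintro ⟨h₁, h₂⟩
    simp only [h₁, h₂, and_self]

/-- Soundness: derivability from axioms true at both worlds preserves truth at both worlds. -/
theorem sat_of_derivable {Ax : Formula Θ → Prop} (hAx : ∀ φ, Ax φ → ∀ w, φ.Sat V w)
    (h : Derivable Ax φ) (w : Bool) : φ.Sat V w := by
  induction h generalizing w with
  | ax h => exact hAx _ h w
  | mp _ _ ih₁ ih₂ => exact ih₂ w (ih₁ w)
  | nec _ ih => exact ⟨ih w, ih (!w)⟩

theorem sat_toFormula (φ : ClassicalFormula Θ) (w : Bool) :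
    φ.toFormula.Sat V w ↔ φ.Holds (V w) := by
  induction φ with
  | atom θ => rfl
  | neg φ ih => exact not_congr ih
  | imp φ ψ ih₁ ih₂ => exact imp_congr ih₁ ih₂

end Formula

/-- Non-distortion for every system that is sound for the two-world models. -/
theorem provableC_or_of_derivable {Ax : Formula Θ → Prop}
    (hAx : ∀ (V : Bool → Θ → Prop) (φ : Formula Θ), Ax φ → ∀ w, φ.Sat V w)
    {φ : ClassicalFormula Θ}
    (h : Derivable Ax (.or (.box φ.toFormula) (.box (.neg φ.toFormula)))) :
    ProvableC φ ∨ ProvableC (.neg φ) := by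
  by_contra! hn
  obtain ⟨V₁, h₁⟩ := ClassicalFormula.exists_not_holds hn.1
  obtain ⟨V₂, h₂⟩ := ClassicalFormula.exists_not_holds hn.2
  -- `φ` fails at world `true` and holds at world `false`.
  have key := Formula.sat_of_derivable (hAx fun w => bif w then V₁ else V₂) h true
  simp only [Formula.or, Formula.Sat, Formula.sat_toFormula, ClassicalFormula.Holds,
    Bool.not_true, cond_true, cond_false] at key h₂
  tauto

end BayesLogic

theorem mainTheorem5 {Θ : Type*} (φ : BayesLogic.ClassicalFormula Θ) :
    (BayesLogic.ProvableDmBLStar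
        (.or (.box φ.toFormula) (.box (.neg φ.toFormula))) →
      BayesLogic.ProvableC φ ∨ BayesLogic.ProvableC (.neg φ)) ∧
    (BayesLogic.ProvableDmBL
        (.or (.box φ.toFormula) (.box (.neg φ.toFormula))) →
      BayesLogic.ProvableC φ ∨ BayesLogic.ProvableC (.neg φ)) :=
  ⟨BayesLogic.provableC_or_of_derivable fun _ _ => BayesLogic.Formula.sat_of_axiomDmBLStar,
    BayesLogic.provableC_or_of_derivable fun _ _ => BayesLogic.Formula.sat_of_axiomDmBL⟩
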